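/- Let $k$ be a commutative ring and let $(H,\cdot,1,\Delta,\varepsilon,S)$ be a Hopf algebra over $k$ with convolution dual algebra $\hat H=\mathrm{Hom}_k(H,k)$. Let $(\lambda,i)$ be a dual pair of Frobenius left integrals. That is, $\lambda\in\hat H$ satisfies $a_{(1)}\lambda(a_{(2)})=\lambda(a)1$ and is a Frobenius homomorphism $H\to k$; $i\in H$ satisfies $ai=\varepsilon(a)i$ and $f\mapsto f(i)$ is a Frobenius homomorphism $\hat H\to k$; and $i_{(1)}\lambda(i_{(2)})=1$. Here a Frobenius homomorphism from an algebra $A$ to a subalgebra $X$ (or to $k$) is an $X$-$X$-bimodule map $\Phi:A\to X$ with dual bases, i.e. finitely many $x_j,y_j\in A$ with $\sum_j\Phi(ax_j)y_j=a=\sum_j x_j\Phi(y_ja)$ for all $a$. Its comultiplication is $\Delta_\Phi(a)=\sum_j ax_j\otimes_X y_j$, and its Nakayama automorphism $\nu_\Phi$ is the algebra automorphism of the centralizer of $X$ in $A$ with $\Phi(ac)=\Phi(\nu_\Phi(c)a)$. A double algebra $\langle A,\circ,e,\star,i\rangle$ is a $k$-module $A$ with two associative unital $k$-algebra structures $V=\langle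 A,\circ,e\rangle$ and $\langle A,\star,i\rangle$ such that, with $\Phi_L(a)=a\star e$, $\Phi_R(a)=e\star a$, $\Phi_B(a)=a\circ i$, $\Phi_T(a)=i\circ a$, for all $a,b\in A$: $$\begin{aligned} \Phi_L(a)\circ b&=\Phi_B\Phi_L(a)\star b, & a\circ\Phi_L(b)&=\Phi_T\Phi_L(b)\star a, & \Phi_B(a)\star b&=\Phi_L\Phi_B(a)\circ b, & a\star\Phi_B(b)&=\Phi_R\Phi_B(b)\circ a,\\ a\circ\Phi_R(b)&=a\star\Phi_T\Phi_R(b), & \Phi_R(a)\circ b&=b\star\Phi_B\Phi_R(a), & a\star\Phi_T(b)&=a\circ\Phi_R\Phi_T(b), & \Phi_T(a)\star b&=b\circ\Phi_L\Phi_T(a). \end{aligned}$$ Its base algebras are the images $L,R,B,T$ of $\Phi_L,\Phi_R,\Phi_B,\Phi_T$. It is Frobenius if $\Phi_L,\Phi_R$ are Frobenius homomorphisms onto $L,R\subset\langle A,\circ,e\rangle$ and $\Phi_B,\Phi_T$ onto $B,T\subset\langle A,\star,i\rangle$; let $\Delta_L,\Delta_R,\Delta_B,\Delta_T$ denote their comultiplications,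 written $\Delta_X(a)=a_1\otimes_X a_2$. It is distributive if moreover, for all $a,a',a''$, $$\begin{aligned} a\circ(a'\star a'')&=(a_1\circ a')\star(a_2\circ a'')\ \ (\Delta_B), & a\star(a'\circ a'')&=(a_1\star a')\circ(a_2\star a'')\ \ (\Delta_L),\\ (a'\star a'')\circ a&=(a'\circ a_1)\star(a''\circ a_2)\ \ (\Delta_T), & (a'\circ a'')\star a&=(a'\star a_1)\circ(a''\star a_2)\ \ (\Delta_R). \end{aligned}$$ An antipode of a double algebra is a $k$-linear map $\tilde S:A\to A$ with $$\begin{aligned} \Phi_B(a'\star(a''\circ a))&=\Phi_B((a'\circ\tilde S(a))\star a''), & \Phi_R(a'\circ(a\star a''))&=\Phi_R((\tilde S(a)\star a')\circ a''),\\ \Phi_L((a'\star a)\circ a'')&=\Phi_L(a'\circ(a''\star\tilde S(a))), & \Phi_T((a\circ a')\star a'')&=\Phi_T(a'\star(\tilde S(a)\circ a'')). \end{aligned}$$ **Proposition.** The antipode $S$ is invertible, and the Fourier transforms $\mathcal F:H\to\hat H$, $\mathcal F(a)(b)=\lambda(ba)$, and $\mathcal F^{-1}(\psi)=\psi(S^{-1}(i_{(1)}))\,i_{(2)}$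 are mutually inverse. Put $a\star a'=\mathcal F^{-1}(\mathcal F(a)\mathcal F(a'))$. 1. $\langle H,\cdot,1,\star,i\rangle$ is a distributive Frobenius double algebra. 2. Its base algebras are $L=R=k\cdot 1$ and $B=T=k\cdot i$. 3. It has a unique antipode $\tilde S$. This $\tilde S$ is invertible and is the Connes–Moscovici deformed antipode: $\tilde S=\nu^{-1}S^{-1}$, where $\nu$ is the Nakayama automorphism of $\lambda$, and $\tilde S(a)=\sigma(a_{(1)})S(a_{(2)})$ with $\sigma(a)=\lambda(ia)$. 4. The Hopf algebra is reconstructed from the double algebra as $\langle H,\cdot,1,\Delta_B,\Phi_B,\tilde S^{-1}\nu_L^{-1}\rangle$. That is: $c\mapsto c\,i$ is a bijection $k\to B$ and the canonical map $H\otimes_k H\to H\otimes_B H$ is bijective; under these identifications $\varepsilon=\Phi_B$ and $\Delta=\Delta_B$; moreover the centralizer of $L$ in $V$ is $H$ and $S=\tilde S^{-1}\nu_L^{-1}$, where $\nu_L$ is the Nakayama automorphism of $\Phi_L$. -/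

import Mathlib

open scoped TensorProduct

noncomputable section

/-! ### Frobenius homomorphisms, their comultiplications and Nakayama automorphisms

An algebra structure on a `k`-module `A` is given here by its bilinear product `m`, because the
same module is going to carry two of them. -/

section Frobenius

variable {k A : Type*} [CommRing k] [AddCommGroup A] [Module k A]

/-- `x`, `y` are dual bases of `Φ` with respect to the product `m`:
`∑ Φ(a x_j) y_j = a = ∑ x_j Φ(y_j a)`. -/
def IsDualBasis (m : A →ₗ[k] A →ₗ[k] A) (Φ : A →ₗ[k] A) {n : ℕ} (x y : Fin n → A) : Prop :=
  ∀ a : A, ∑ j, m (Φ (m a (x j))) (y j) = a ∧ ∑ j, m (x j) (Φ (m (y j) a)) = a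

/-- `Φ` is a Frobenius homomorphism from the algebra `⟨A, m, u⟩` to its subalgebra `X`:
an `X`-`X`-bimodule map with values in `X` that possesses dual bases. -/
structure IsFrobeniusHom (m : A →ₗ[k] A →ₗ[k] A) (u : A) (X : Submodule k A)
    (Φ : A →ₗ[k] A) : Prop where
  one_mem : u ∈ X
  mul_mem : ∀ x ∈ X, ∀ y ∈ X, m x y ∈ X
  map_mem : ∀ a, Φ a ∈ X
  map_left : ∀ x ∈ X, ∀ a, Φ (m x a) = m x (Φ a)
  map_right : ∀ x ∈ X, ∀ a, Φ (m a x) = m (Φ a) x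
  exists_dualBasis : ∃ (n : ℕ) (x y : Fin n → A), IsDualBasis m Φ x y

/-- The relations `a x ⊗ b = a ⊗ x b`, `x ∈ X`, which define the tensor product over `X`. -/
def balancingRelations (m : A →ₗ[k] A →ₗ[k] A) (X : Submodule k A) : Submodule k (A ⊗[k] A) :=
  Submodule.span k {t | ∃ a b : A, ∃ x ∈ X, t = m a x ⊗ₜ[k] b - a ⊗ₜ[k] m x b}

/-- The tensor square `A ⊗_X A` of the `X`-`X`-bimodule `A`. -/
abbrev TensorOver (m : A →ₗ[k] A →ₗ[k] A) (X : Submodule k A) : Type _ :=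
  (A ⊗[k] A) ⧸ balancingRelations m X

/-- The canonical map `A ⊗_k A → A ⊗_X A`. -/
def toTensorOver (m : A →ₗ[k] A →ₗ[k] A) (X : Submodule k A) :
    A ⊗[k] A →ₗ[k] TensorOver m X :=
  (balancingRelations m X).mkQ

/-- `Δ` is the comultiplication `Δ(a) = ∑ a x_j ⊗_X y_j` of the Frobenius homomorphism `Φ`, where
`∑ x_j ⊗_X y_j` is the dual basis of `Φ` (any choice of dual bases gives the same element). -/
def IsFrobeniusComul (m : A →ₗ[k] A →ₗ[k] A) (X : Submodule k A) (Φ : A →ₗ[k] A)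
    (Δ : A →ₗ[k] TensorOver m X) : Prop :=
  ∀ (n : ℕ) (x y : Fin n → A), IsDualBasis m Φ x y →
    ∀ a, Δ a = toTensorOver m X (∑ j, m a (x j) ⊗ₜ[k] y j)

/-- The centralizer of `X` in the algebra with product `m`. -/
def centralizerOf (m : A →ₗ[k] A →ₗ[k] A) (X : Submodule k A) : Submodule k A where
  carrier := {c | ∀ x ∈ X, m c x = m x c}
  add_mem' {a b} ha hb x hx := by simp [ha x hx, hb x hx]
  zero_mem' x _ := by simp
  smul_mem' r a ha x hx := by simp [ha x hx]

/-- `ν` is the Nakayama automorphism of `Φ`: an algebra automorphism of the centralizer of `X`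
such that `Φ(a c) = Φ(ν(c) a)`. -/
structure IsNakayama (m : A →ₗ[k] A →ₗ[k] A) (X : Submodule k A) (Φ : A →ₗ[k] A)
    (ν : centralizerOf m X ≃ₗ[k] centralizerOf m X) : Prop where
  map_mul : ∀ c d e : centralizerOf m X, (e : A) = m c d → (ν e : A) = m (ν c) (ν d)
  twist : ∀ (a : A) (c : centralizerOf m X), Φ (m a c) = Φ (m (ν c) a)

end Frobenius

/-! ### Double algebras -/

/-- The data of a double algebra: the vertical structure `⟨A, ∘, e⟩` and the horizontal structure
`⟨A, ⋆, i⟩` on the same `k`-module. -/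
structure DoubleProduct (k A : Type*) [CommRing k] [AddCommGroup A] [Module k A] where
  vmul : A →ₗ[k] A →ₗ[k] A
  e : A
  hmul : A →ₗ[k] A →ₗ[k] A
  i : A

namespace DoubleProduct

variable {k A : Type*} [CommRing k] [AddCommGroup A] [Module k A] (D : DoubleProduct k A)

/-- The axioms of a double algebra. -/
structure IsDoubleAlgebra : Prop where
  vmul_assoc : ∀ a b c, D.vmul (D.vmul a b) c = D.vmul a (D.vmul b c)
  e_vmul : ∀ a, D.vmul D.e a = a
  vmul_e : ∀ a, D.vmul a D.e = a
  hmul_assoc : ∀ a b c, D.hmul (D.hmul a b) c = D.hmul a (D.hmul b c)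
  i_hmul : ∀ a, D.hmul D.i a = a
  hmul_i : ∀ a, D.hmul a D.i = a
  ax1 : ∀ a b, D.vmul (D.hmul a D.e) b = D.hmul (D.vmul (D.hmul a D.e) D.i) b
  ax2 : ∀ a b, D.vmul a (D.hmul b D.e) = D.hmul (D.vmul D.i (D.hmul b D.e)) a
  ax3 : ∀ a b, D.hmul (D.vmul a D.i) b = D.vmul (D.hmul (D.vmul a D.i) D.e) b
  ax4 : ∀ a b, D.hmul a (D.vmul b D.i) = D.vmul (D.hmul D.e (D.vmul b D.i)) a
  ax5 : ∀ a b, D.vmul a (D.hmul D.e b) = D.hmul a (D.vmul D.i (D.hmul D.e b))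
  ax6 : ∀ a b, D.vmul (D.hmul D.e a) b = D.hmul b (D.vmul (D.hmul D.e a) D.i)
  ax7 : ∀ a b, D.hmul a (D.vmul D.i b) = D.vmul a (D.hmul D.e (D.vmul D.i b))
  ax8 : ∀ a b, D.hmul (D.vmul D.i a) b = D.vmul b (D.hmul (D.vmul D.i a) D.e)

/-- `Φ_L(a) = a ⋆ e`. -/
def phiL : A →ₗ[k] A := D.hmul.flip D.e

/-- `Φ_R(a) = e ⋆ a`. -/
def phiR : A →ₗ[k] A := D.hmul D.e

/-- `Φ_B(a) = a ∘ i`. -/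
def phiB : A →ₗ[k] A := D.vmul.flip D.i

/-- `Φ_T(a) = i ∘ a`. -/
def phiT : A →ₗ[k] A := D.vmul D.i

/-- The left base algebra. -/
def baseL : Submodule k A := LinearMap.range D.phiL

/-- The right base algebra. -/
def baseR : Submodule k A := LinearMap.range D.phiR

/-- The bottom base algebra. -/
def baseB : Submodule k A := LinearMap.range D.phiB

/-- The top base algebra. -/
def baseT : Submodule k A := LinearMap.range D.phiT

/-- Frobenius double algebras: the four base homomorphisms are Frobenius homomorphisms onto the
subalgebras `L`, `R` of the vertical and `B`, `T` of the horizontal algebra. -/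
structure IsFrobenius : Prop extends D.IsDoubleAlgebra where
  frobL : IsFrobeniusHom D.vmul D.e D.baseL D.phiL
  frobR : IsFrobeniusHom D.vmul D.e D.baseR D.phiR
  frobB : IsFrobeniusHom D.hmul D.i D.baseB D.phiB
  frobT : IsFrobeniusHom D.hmul D.i D.baseT D.phiT

/-- Distributive Frobenius double algebras. The Sweedler components occurring in the four laws are
those of `Δ_B(a) = a ⋆ u_j ⊗_B v_j`, `Δ_L(a) = a ∘ x_j ⊗_L y_j`, `Δ_T(a) = a ⋆ u^j ⊗_T v^j` and
`Δ_R(a) = a ∘ x^j ⊗_R y^j`, written out with arbitrary dual bases of the base homomorphisms. -/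
structure IsDistributive : Prop extends D.IsFrobenius where
  distribB : ∀ (n : ℕ) (u v : Fin n → A), IsDualBasis D.hmul D.phiB u v → ∀ a b c,
    D.vmul a (D.hmul b c) =
      ∑ j, D.hmul (D.vmul (D.hmul a (u j)) b) (D.vmul (v j) c)
  distribL : ∀ (n : ℕ) (x y : Fin n → A), IsDualBasis D.vmul D.phiL x y → ∀ a b c,
    D.hmul a (D.vmul b c) =
      ∑ j, D.vmul (D.hmul (D.vmul a (x j)) b) (D.hmul (y j) c)
  distribT : ∀ (n : ℕ) (u v : Fin n → A), IsDualBasis D.hmul D.phiT u v → ∀ a b c,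
    D.vmul (D.hmul b c) a =
      ∑ j, D.hmul (D.vmul b (D.hmul a (u j))) (D.vmul c (v j))
  distribR : ∀ (n : ℕ) (x y : Fin n → A), IsDualBasis D.vmul D.phiR x y → ∀ a b c,
    D.hmul (D.vmul b c) a =
      ∑ j, D.vmul (D.hmul b (D.vmul a (x j))) (D.hmul c (y j))

/-- `s` is an antipode for the double algebra. -/
structure IsAntipode (s : A →ₗ[k] A) : Prop where
  antiB : ∀ a b c, D.phiB (D.hmul b (D.vmul c a)) = D.phiB (D.hmul (D.vmul b (s a)) c)
  antiR : ∀ a b c, D.phiR (D.vmul b (D.hmul a c)) = D.phiR (D.vmul (D.hmul (s a) b) c)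
  antiL : ∀ a b c, D.phiL (D.vmul (D.hmul b a) c) = D.phiL (D.vmul b (D.hmul c (s a)))
  antiT : ∀ a b c, D.phiT (D.hmul (D.vmul a b) c) = D.phiT (D.hmul b (D.vmul (s a) c))

end DoubleProduct

/-! ### Hopf algebras with Frobenius integrals -/

section Hopf

variable {k : Type*} [CommRing k]

/-- `φ` is a Frobenius homomorphism from the `k`-algebra `R` to `k`, i.e. it has dual bases
`∑ φ(a x_j) y_j = a = ∑ x_j φ(y_j a)`. -/
def IsFrobeniusFunctional {R : Type*} [Ring R] [Algebra k R] (φ : R →ₗ[k] k) : Prop :=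
  ∃ (n : ℕ) (x y : Fin n → R), ∀ a : R,
    ∑ j, φ (a * x j) • y j = a ∧ ∑ j, φ (y j * a) • x j = a

variable {H : Type*} [Ring H] [HopfAlgebra k H]

/-- `ψ ⇀ a = a₍₁₎ ψ(a₍₂₎)`. -/
def leftHit (ψ : H →ₗ[k] k) : H →ₗ[k] H :=
  (TensorProduct.rid k H).toLinearMap ∘ₗ ψ.lTensor H ∘ₗ Coalgebra.comul

/-- `a ↼ ψ = ψ(a₍₁₎) a₍₂₎`. -/
def rightHit (ψ : H →ₗ[k] k) : H →ₗ[k] H :=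
  (TensorProduct.lid k H).toLinearMap ∘ₗ ψ.rTensor H ∘ₗ Coalgebra.comul

/-- Evaluation `f ↦ f(a)` on the dual algebra of `H`, whose product is convolution. -/
def evalAt (a : H) : WithConv (H →ₗ[k] k) →ₗ[k] k :=
  LinearMap.applyₗ a ∘ₗ (WithConv.linearEquiv k (H →ₗ[k] k)).toLinearMap

/-- `(lam, i)` is a dual pair of Frobenius left integrals: `lam` is a left integral on `H` and a
Frobenius homomorphism on `H`, `i` is a left integral in `H` such that `f ↦ f(i)` is a Frobenius
homomorphism on the dual algebra, and `lam ⇀ i = 1`. -/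
structure IsDualPair (lam : H →ₗ[k] k) (i : H) : Prop where
  integral_lam : ∀ a : H, leftHit lam a = lam a • (1 : H)
  frobenius_lam : IsFrobeniusFunctional lam
  integral_i : ∀ a : H, a * i = Coalgebra.counit (R := k) a • i
  frobenius_i : IsFrobeniusFunctional (evalAt (k := k) i)
  dual : leftHit lam i = 1

/-- The Fourier transform `F(a) = a ⇀ lam`, i.e. `F(a)(b) = lam(b a)`. -/
def fourierMap (lam : H →ₗ[k] k) : H →ₗ[k] (H →ₗ[k] k) :=
  (LinearMap.mul k H).flip.compr₂ lam

/-- The inverse Fourier transform `ψ ↦ i ↼ (ψ S⁻¹)`, for an invertible antipode `S`. -/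
def invFourier (i : H) (S : H ≃ₗ[k] H) : (H →ₗ[k] k) →ₗ[k] H where
  toFun ψ := rightHit (ψ ∘ₗ S.symm.toLinearMap) i
  map_add' φ ψ := by simp [rightHit, LinearMap.add_comp, LinearMap.rTensor_add]
  map_smul' r ψ := by simp [rightHit, LinearMap.smul_comp, LinearMap.rTensor_smul]

/-- The convolution product `(φ ψ)(a) = φ(a₍₁₎) ψ(a₍₂₎)` of the dual algebra. -/
def dualMul : (H →ₗ[k] k) →ₗ[k] (H →ₗ[k] k) →ₗ[k] (H →ₗ[k] k) :=
  LinearMap.mk₂ k (fun φ ψ => (WithConv.toConv φ * WithConv.toConv ψ).ofConv)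
    (fun φ φ' ψ => by simp [add_mul])
    (fun c φ ψ => by rw [WithConv.toConv_smul, smul_mul_assoc, WithConv.ofConv_smul])
    (fun φ ψ ψ' => by simp [mul_add])
    (fun c φ ψ => by rw [WithConv.toConv_smul, mul_smul_comm, WithConv.ofConv_smul])

/-- The convolution product `a ⋆ b = F⁻¹(F(a) F(b))`. -/
def starMul (lam : H →ₗ[k] k) (i : H) (S : H ≃ₗ[k] H) : H →ₗ[k] H →ₗ[k] H :=
  (dualMul.compl₁₂ (fourierMap lam) (fourierMap lam)).compr₂ (invFourier i S)

/-- The data `⟨H, ·, 1, ⋆, i⟩`. -/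
def hopfDouble (lam : H →ₗ[k] k) (i : H) (S : H ≃ₗ[k] H) : DoubleProduct k H where
  vmul := LinearMap.mul k H
  e := 1
  hmul := starMul lam i S
  i := i

/-- The distinguished grouplike element `σ = lam ↼ i` of the dual algebra, `σ(a) = lam(i a)`. -/
def distinguished (lam : H →ₗ[k] k) (i : H) : H →ₗ[k] k :=
  lam ∘ₗ LinearMap.mulLeft k i

/-- The deformed antipode `a ↦ S(a ↼ σ) = σ(a₍₁₎) S(a₍₂₎)`. -/
def deformedAntipode (σ : H →ₗ[k] k) : H →ₗ[k] H :=
  HopfAlgebra.antipode k ∘ₗ rightHit σ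

end Hopf

end

/-! Everything flows from one identity, `IsDualPair.leftHit_mulLeft`: `a₍₁₎ λ(b a₍₂₎) = S(b₍₁₎)
λ(b₍₂₎ a)`. At `a = i` it reads `i₍₁₎ λ(b i₍₂₎) = S(b)`. Since `λ` and evaluation at `i` are
Frobenius, every element has the form `i₍₁₎ λ(b i₍₂₎)`, so `S` is surjective, hence bijective
because `H` is finite over `k`. The same formula yields Fourier inversion and the
anticomultiplicativity of `S`.

Inversion turns `⋆` into convolution: `λ(x (a ⋆ b)) = λ(x₍₁₎ a) λ(x₍₂₎ b)`. As `λ` is nondegenerate,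
identities for `⋆` can be tested under `λ(x ·)`. The four base maps are scalar functionals `λ`, `λ
S⁻¹`, `ε`, `σ` times `1` or `i`. Dual bases of the first two come from `λ`, those of `ε` from
`Δ(i)`, those of `σ` from `(ν⁻¹ ⊗ ν⁻¹) Δ(S⁻¹ i)`. Distributivity combines these with the
multiplicativity of `Δ`.

The antipode axioms reduce to `λ(b s(a)) = λ(S⁻¹(a) b)`, which says `s = ν⁻¹ S⁻¹`; the exchange rule
`IsDualPair.comul_i_mul_tmul_one` identifies this map with the deformed antipode. -/

open Coalgebra HopfAlgebra

/-! ### Actions of functionals on `H` and convolution. -/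

section Hits

variable {k : Type*} [CommRing k] {H : Type*} [Ring H] [HopfAlgebra k H]

lemma leftHit_eq_sum (f : H →ₗ[k] k) {a : H} {ι : Type*} (r : Repr k a ι) :
    leftHit f a = ∑ j ∈ r.index, f (r.right j) • r.left j := by
  simp [leftHit, ← r.eq]

lemma rightHit_eq_sum (f : H →ₗ[k] k) {a : H} {ι : Type*} (r : Repr k a ι) :
    rightHit f a = ∑ j ∈ r.index, f (r.left j) • r.right j := by
  simp [rightHit, ← r.eq]

lemma dualMul_eq_sum (f g : H →ₗ[k] k) {a : H} {ι : Type*} (r : Repr k a ι) :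
    dualMul f g a = ∑ j ∈ r.index, f (r.left j) * g (r.right j) := by
  simp [dualMul, LinearMap.convMul_apply, ← r.eq]

lemma dualMul_apply_leftHit (f g : H →ₗ[k] k) (a : H) : dualMul f g a = f (leftHit g a) := by
  simp [dualMul_eq_sum f g (ℛ k a), leftHit_eq_sum g (ℛ k a), mul_comm]

lemma dualMul_apply_rightHit (f g : H →ₗ[k] k) (a : H) : dualMul f g a = g (rightHit f a) := by
  simp [dualMul_eq_sum f g (ℛ k a), rightHit_eq_sum f (ℛ k a)]

/-- Both sides are the convolution `f * g` at `a`; this adjunction moves functionals between the two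
legs of `Δ`. -/
lemma apply_leftHit (f g : H →ₗ[k] k) (a : H) : f (leftHit g a) = g (rightHit f a) := by
  rw [← dualMul_apply_leftHit, dualMul_apply_rightHit]

lemma leftHit_counit (a : H) : leftHit (counit (R := k)) a = a := by
  simp [leftHit]

lemma rightHit_counit (a : H) : rightHit (counit (R := k)) a = a := by
  simp [rightHit]

/-- Coassociativity: contracting the last of three legs commutes with splitting off the first. -/
lemma comul_leftHit (f : H →ₗ[k] k) (a : H) :
    comul (R := k) (leftHit f a) = (leftHit f).lTensor H (comul a) := by
  have h1 : ∀ t : H ⊗[k] H, comul (R := k) (TensorProduct.rid k H (f.lTensor H t)) =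
      ((TensorProduct.rid k H).toLinearMap ∘ₗ f.lTensor H).lTensor H
        (TensorProduct.assoc k H H H (comul.rTensor H t)) := by
    intro t
    induction t with
    | zero => simp
    | add x y hx hy => simp only [map_add, hx, hy]
    | tmul x y =>
      have h2 : ∀ s : H ⊗[k] H, f y • s =
        ((TensorProduct.rid k H).toLinearMap ∘ₗ f.lTensor H).lTensor H
          (TensorProduct.assoc k H H H (s ⊗ₜ y)) := by
        intro s
        induction s with
        | zero => simp
        | add x y hx hy => simp only [map_add, smul_add, TensorProduct.add_tmul, hx, hy]
        | tmul u v => simp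
      simpa using h2 (comul x)
  have := h1 (comul a)
  rw [Coalgebra.coassoc_apply, ← LinearMap.lTensor_comp_apply] at this
  exact this

lemma dualMul_assoc (f g h : H →ₗ[k] k) : dualMul (dualMul f g) h = dualMul f (dualMul g h) := by
  simp [dualMul, mul_assoc]

end Hits

/-! ### Cancelling convolution-invertible maps. -/

section Convolution

variable {k : Type*} [CommRing k] {H : Type*} [Ring H] [HopfAlgebra k H]
  {A : Type*} [Ring A] [Algebra k A]

open WithConv

/-- If `P * Q` is known and `Q` has the convolution inverse `Q'`, then `P = (P * Q) * Q'`. -/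
lemma eq_conv_of_conv_mul {P Q Q' R : H →ₗ[k] A} (hQ : toConv Q * toConv Q' = 1)
    (h : toConv P * toConv Q = toConv R) : toConv P = toConv R * toConv Q' := by
  rw [← h, mul_assoc, hQ, mul_one]

lemma eq_conv_of_mul_conv {P Q Q' R : H →ₗ[k] A} (hQ : toConv Q' * toConv Q = 1)
    (h : toConv Q * toConv P = toConv R) : toConv P = toConv Q' * toConv R := by
  rw [← h, ← mul_assoc, hQ, one_mul]

lemma convMul_eq_sum (P Q : H →ₗ[k] A) {a : H} {ι : Type*} (r : Repr k a ι) :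
    (toConv P * toConv Q) a = ∑ j ∈ r.index, P (r.left j) * Q (r.right j) := by
  simp [LinearMap.convMul_apply, ← r.eq]

end Convolution

/-! ### Fourier inversion, bijectivity of the antipode, and formulas for `⋆`. -/

section DualPair

variable {k : Type*} [CommRing k] {H : Type*} [Ring H] [HopfAlgebra k H]
  {lam : H →ₗ[k] k} {i : H}

open WithConv

@[simp] lemma fourierMap_apply (a b : H) : fourierMap lam a b = lam (b * a) := rfl

/-- `b₍₁₎ a₍₁₎ lam(b₍₂₎ a₍₂₎) = lam(b a)`, solved for `a₍₁₎ lam(b a₍₂₎) = S(b₍₁₎) lam(b₍₂₎ a)`. -/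
lemma IsDualPair.leftHit_mulLeft (h : IsDualPair lam i) (a b : H) :
    leftHit (lam ∘ₗ LinearMap.mulLeft k b) a = antipode k (leftHit (fourierMap lam a) b) := by
  let P : H →ₗ[k] H :=
    { toFun := fun b => leftHit (lam ∘ₗ LinearMap.mulLeft k b) a
      map_add' := fun x y => by
        simp [leftHit_eq_sum _ (ℛ k a), add_mul, add_smul, Finset.sum_add_distrib]
      map_smul' := fun c x => by
        simp [leftHit_eq_sum _ (ℛ k a), mul_smul, Finset.smul_sum] }
  have hP : ∀ b, P b = leftHit (lam ∘ₗ LinearMap.mulLeft k b) a := fun _ => rfl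
  -- This is left invariance of `λ` at `b a`, with `Δ(b a) = Δ(b) Δ(a)`; convolving on the left with
  -- `S` then cancels the identity map.
  have key : toConv (LinearMap.id : H →ₗ[k] H) * toConv P =
      toConv ((fourierMap lam a).smulRight (1 : H)) := by
    ext b
    rw [convMul_eq_sum _ _ (ℛ k b)]
    have h2 := h.integral_lam (b * a)
    rw [leftHit_eq_sum _ ((ℛ k b).mul (ℛ k a))] at h2
    simp only [hP, leftHit_eq_sum _ (ℛ k a)]
    simpa [Finset.sum_product, Finset.mul_sum] using h2
  have h3 := eq_conv_of_mul_conv LinearMap.antipode_mul_id key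
  have h4 := congrArg (fun f => f.ofConv b) h3
  have h5 := convMul_eq_sum (antipode k) ((fourierMap lam a).smulRight (1 : H)) (ℛ k b)
  replace h4 := h4.trans h5
  change P b = _ at h4
  rw [← hP, h4, leftHit_eq_sum _ (ℛ k b)]
  simp

lemma IsDualPair.lam_i (h : IsDualPair lam i) : lam i = 1 := by
  have h1 := h.integral_lam i
  rw [h.dual] at h1
  simpa using (congrArg (counit (R := k)) h1).symm

lemma IsDualPair.fourierMap_i (h : IsDualPair lam i) : fourierMap lam i = counit (R := k) := by
  ext b
  simp [h.integral_i, h.lam_i]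

lemma IsDualPair.leftHit_mulLeft_i (h : IsDualPair lam i) (b : H) :
    leftHit (lam ∘ₗ LinearMap.mulLeft k b) i = antipode k b := by
  rw [h.leftHit_mulLeft, h.fourierMap_i, leftHit_counit]

/-- One half of the dual basis property gives injectivity; the other supplies the explicit preimage.
-/
lemma IsDualPair.bijective_fourierMap (h : IsDualPair lam i) :
    Function.Bijective (fourierMap lam) := by
  obtain ⟨n, x, y, hxy⟩ := h.frobenius_lam
  constructor
  · rw [injective_iff_map_eq_zero]
    intro a ha
    rw [← (hxy a).2]
    refine Finset.sum_eq_zero fun j _ => ?_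
    rw [← fourierMap_apply, ha]; simp
  · intro ψ
    refine ⟨∑ j, ψ (y j) • x j, ?_⟩
    ext b
    conv_rhs => rw [← (hxy b).1]
    simp [mul_comm]

lemma IsDualPair.bijective_mulLeft (h : IsDualPair lam i) :
    Function.Bijective (fun b => lam ∘ₗ LinearMap.mulLeft k b) := by
  obtain ⟨n, x, y, hxy⟩ := h.frobenius_lam
  constructor
  · intro a b hab
    rw [← (hxy a).1, ← (hxy b).1]
    refine Finset.sum_congr rfl fun j _ => ?_
    congr 1
    exact LinearMap.congr_fun hab (x j)
  · intro ψ
    refine ⟨∑ j, ψ (x j) • y j, ?_⟩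
    ext b
    conv_rhs => rw [← (hxy b).2]
    simp [Finset.sum_mul, mul_comm]

lemma IsDualPair.finite (h : IsDualPair lam i) : Module.Finite k H := by
  classical
  obtain ⟨n, x, y, hxy⟩ := h.frobenius_lam
  refine ⟨⟨Finset.univ.image y, ?_⟩⟩
  rw [eq_top_iff]
  rintro a -
  rw [← (hxy a).1]
  exact Submodule.sum_mem _ fun j _ => Submodule.smul_mem _ _ (Submodule.subset_span (by simp))

/-- Expand the functional `λ(b ·)` in dual bases of evaluation at `i`, evaluate at `a`, and use
nondegeneracy of `λ` to remove `b`. -/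
lemma IsDualPair.surjective_leftHit_i (h : IsDualPair lam i) (a : H) :
    ∃ f : H →ₗ[k] k, leftHit f i = a := by
  obtain ⟨n, x, y, hxy⟩ := h.frobenius_i
  refine ⟨∑ j, (y j) a • (x j).ofConv, ?_⟩
  apply h.bijective_fourierMap.1
  ext b
  have h1 := congrArg (fun f => f.ofConv a) (hxy (toConv (lam ∘ₗ LinearMap.mulLeft k b))).1
  have h2 : ∀ j, evalAt (k := k) i (toConv (lam ∘ₗ LinearMap.mulLeft k b) * x j) =
      (lam ∘ₗ LinearMap.mulLeft k b) (leftHit (x j).ofConv i) := fun j =>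
    dualMul_apply_leftHit (lam ∘ₗ LinearMap.mulLeft k b) (x j).ofConv i
  have h3 : leftHit (∑ j, (y j) a • (x j).ofConv) i = ∑ j, (y j) a • leftHit (x j).ofConv i := by
    simp only [leftHit_eq_sum _ (ℛ k i), LinearMap.sum_apply, Finset.sum_smul, Finset.smul_sum,
      LinearMap.smul_apply, smul_smul, smul_eq_mul]
    exact Finset.sum_comm
  simp only [h2] at h1
  rw [fourierMap_apply, fourierMap_apply, h3, Finset.mul_sum, map_sum]
  simpa [mul_comm] using h1

/-- Any `a` is `i₍₁₎ f(i₍₂₎)`, and `f = λ(b ·)` for some `b`, so `a = S(b)`. A surjective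
endomorphism of a finite module over a commutative ring is injective. -/
lemma IsDualPair.bijective_antipode (h : IsDualPair lam i) :
    Function.Bijective (antipode k : H →ₗ[k] H) := by
  have := h.finite
  refine OrzechProperty.bijective_of_surjective_endomorphism _ fun a => ?_
  obtain ⟨f, rfl⟩ := h.surjective_leftHit_i a
  obtain ⟨b, rfl⟩ := h.bijective_mulLeft.2 f
  exact ⟨b, (h.leftHit_mulLeft_i b).symm⟩

/-- The antipode is an anticoalgebra map. -/
lemma IsDualPair.comul_antipode (h : IsDualPair lam i) (b : H) :
    comul (R := k) (antipode k b) =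
      TensorProduct.map (antipode k) (antipode k) (TensorProduct.comm k H H (comul b)) := by
  -- Writing `S(b) = i₍₁₎ λ(b i₍₂₎)` gives `Δ(S b) = i₍₁₎ ⊗ S(b₍₁₎) λ(b₍₂₎ i₍₂₎)`, and the sum over
  -- `i` reassembles into `S(b₍₂₎)`.
  rw [← h.leftHit_mulLeft_i b, comul_leftHit]
  have h1 : (leftHit (lam ∘ₗ LinearMap.mulLeft k b)).lTensor H (comul i) =
      ∑ j ∈ (ℛ k i).index, (ℛ k i).left j ⊗ₜ[k]
        antipode k (leftHit (fourierMap lam ((ℛ k i).right j)) b) := by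
    conv_lhs => rw [← (ℛ k i).eq]
    simp [h.leftHit_mulLeft]
  have h2 : ∀ c, antipode k c = ∑ j ∈ (ℛ k i).index, lam (c * (ℛ k i).right j) • (ℛ k i).left j :=
    fun c => by rw [← h.leftHit_mulLeft_i, leftHit_eq_sum _ (ℛ k i)]; simp
  rw [h1]
  conv_rhs => rw [← (ℛ k b).eq]
  simp only [leftHit_eq_sum _ (ℛ k b), map_sum, TensorProduct.comm_tmul, TensorProduct.map_tmul,
    TensorProduct.tmul_sum, map_smul, fourierMap_apply]
  rw [Finset.sum_comm]
  refine Finset.sum_congr rfl fun j _ => ?_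
  rw [h2 ((ℛ k b).right j), TensorProduct.sum_tmul]
  simp [TensorProduct.smul_tmul]

variable {S : H ≃ₗ[k] H}

lemma IsDualPair.comul_equiv (h : IsDualPair lam i) (hS : ∀ a, S a = antipode k a) (a : H) :
    comul (R := k) (S a) = ∑ j ∈ (ℛ k a).index, S ((ℛ k a).right j) ⊗ₜ[k] S ((ℛ k a).left j) := by
  rw [hS, h.comul_antipode]
  conv_lhs => rw [← (ℛ k a).eq]
  simp [hS]

lemma IsDualPair.leftHit_antipode (h : IsDualPair lam i) (hS : ∀ a, S a = antipode k a)
    (f : H →ₗ[k] k) (a : H) : leftHit f (S a) = S (rightHit (f ∘ₗ S.toLinearMap) a) := by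
  rw [rightHit_eq_sum _ (ℛ k a), leftHit, LinearMap.comp_apply, LinearMap.comp_apply,
    h.comul_equiv hS]
  simp

lemma IsDualPair.rightHit_antipode (h : IsDualPair lam i) (hS : ∀ a, S a = antipode k a)
    (f : H →ₗ[k] k) (a : H) : rightHit f (S a) = S (leftHit (f ∘ₗ S.toLinearMap) a) := by
  rw [leftHit_eq_sum _ (ℛ k a), rightHit, LinearMap.comp_apply, LinearMap.comp_apply,
    h.comul_equiv hS]
  simp

lemma symm_mul (hS : ∀ a, S a = antipode k a) (a b : H) :
    S.symm (a * b) = S.symm b * S.symm a := by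
  apply S.injective
  rw [S.apply_symm_apply, hS, antipode_mul_antidistrib, ← hS, ← hS, S.apply_symm_apply,
    S.apply_symm_apply]

lemma invFourier_apply (ψ : H →ₗ[k] k) :
    invFourier i S ψ = rightHit (ψ ∘ₗ S.symm.toLinearMap) i := rfl

/-- By the adjunction `apply_leftHit`, evaluation at `b` becomes `ψ S⁻¹` applied to `i₍₁₎ λ(b i₍₂₎)
= S(b)`. -/
lemma IsDualPair.fourierMap_invFourier (h : IsDualPair lam i) (hS : ∀ a, S a = antipode k a)
    (ψ : H →ₗ[k] k) : fourierMap lam (invFourier i S ψ) = ψ := by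
  ext b
  have := apply_leftHit (ψ ∘ₗ S.symm.toLinearMap) (lam ∘ₗ LinearMap.mulLeft k b) i
  rw [h.leftHit_mulLeft_i, ← hS] at this
  simpa [invFourier_apply] using this.symm

lemma IsDualPair.invFourier_fourierMap (h : IsDualPair lam i) (hS : ∀ a, S a = antipode k a)
    (a : H) : invFourier i S (fourierMap lam a) = a :=
  h.bijective_fourierMap.1 (h.fourierMap_invFourier hS _)

lemma IsDualPair.fourierMap_starMul (h : IsDualPair lam i) (hS : ∀ a, S a = antipode k a)
    (a b : H) :
    fourierMap lam (starMul lam i S a b) = dualMul (fourierMap lam a) (fourierMap lam b) :=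
  h.fourierMap_invFourier hS _

lemma IsDualPair.lam_mul_starMul (h : IsDualPair lam i) (hS : ∀ a, S a = antipode k a)
    (x a b : H) :
    lam (x * starMul lam i S a b) = dualMul (fourierMap lam a) (fourierMap lam b) x :=
  LinearMap.congr_fun (h.fourierMap_starMul hS a b) x

/-- `a ⋆ b = lam(S⁻¹(b₍₁₎) a) b₍₂₎`. -/
lemma IsDualPair.starMul_eq_rightHit (h : IsDualPair lam i) (hS : ∀ a, S a = antipode k a)
    (a b : H) :
    starMul lam i S a b = rightHit (fourierMap lam a ∘ₗ S.symm.toLinearMap) b := by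
  apply h.bijective_fourierMap.1
  ext x
  have h1 := apply_leftHit (fourierMap lam a ∘ₗ S.symm.toLinearMap) (lam ∘ₗ LinearMap.mulLeft k x) b
  rw [h.leftHit_mulLeft, ← hS] at h1
  rw [h.fourierMap_starMul hS, dualMul_apply_leftHit]
  simpa using h1

/-- `a ⋆ b = a₍₁₎ lam(S⁻¹(b) a₍₂₎)`. -/
lemma IsDualPair.starMul_eq_leftHit (h : IsDualPair lam i) (hS : ∀ a, S a = antipode k a)
    (a b : H) :
    starMul lam i S a b = leftHit (lam ∘ₗ LinearMap.mulLeft k (S.symm b)) a := by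
  rw [h.leftHit_mulLeft, h.starMul_eq_rightHit hS, ← hS]
  have := h.rightHit_antipode hS (fourierMap lam a ∘ₗ S.symm.toLinearMap) (S.symm b)
  rw [S.apply_symm_apply] at this
  have h2 : (fourierMap lam a ∘ₗ S.symm.toLinearMap) ∘ₗ S.toLinearMap = fourierMap lam a := by
    ext; simp
  rw [this, h2]

lemma IsDualPair.starMul_assoc (h : IsDualPair lam i) (hS : ∀ a, S a = antipode k a)
    (a b c : H) : starMul lam i S (starMul lam i S a b) c =
      starMul lam i S a (starMul lam i S b c) := by
  apply h.bijective_fourierMap.1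
  simp [h.fourierMap_starMul hS, dualMul_assoc]

lemma IsDualPair.starMul_i (h : IsDualPair lam i) (hS : ∀ a, S a = antipode k a) (a : H) :
    starMul lam i S a i = a := by
  apply h.bijective_fourierMap.1
  ext b
  rw [h.fourierMap_starMul hS, h.fourierMap_i, dualMul_apply_leftHit, leftHit_counit]

lemma IsDualPair.i_starMul (h : IsDualPair lam i) (hS : ∀ a, S a = antipode k a) (a : H) :
    starMul lam i S i a = a := by
  apply h.bijective_fourierMap.1
  ext b
  rw [h.fourierMap_starMul hS, h.fourierMap_i, dualMul_apply_rightHit, rightHit_counit]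

lemma IsDualPair.starMul_one (h : IsDualPair lam i) (hS : ∀ a, S a = antipode k a) (a : H) :
    starMul lam i S a 1 = lam a • (1 : H) := by
  have : S.symm 1 = 1 := by rw [S.symm_apply_eq, hS, antipode_one]
  rw [h.starMul_eq_leftHit hS, this, ← h.integral_lam]
  congr 1
  ext; simp

lemma IsDualPair.one_starMul (h : IsDualPair lam i) (hS : ∀ a, S a = antipode k a) (a : H) :
    starMul lam i S 1 a = lam (S.symm a) • (1 : H) := by
  rw [h.starMul_eq_rightHit hS]
  have := h.rightHit_antipode hS (fourierMap lam 1 ∘ₗ S.symm.toLinearMap) (S.symm a)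
  rw [S.apply_symm_apply] at this
  rw [this]
  have h2 : (fourierMap lam (1 : H) ∘ₗ S.symm.toLinearMap) ∘ₗ S.toLinearMap = lam := by
    ext; simp
  rw [h2, h.integral_lam, map_smul, hS, antipode_one]

/-- Under `λ(b ·)` both sides become `ε(b) λ(i a)`, since `i` is a left integral with `λ(i) = 1`. -/
lemma IsDualPair.i_mul (h : IsDualPair lam i) (a : H) :
    i * a = distinguished lam i a • i := by
  apply h.bijective_fourierMap.1
  ext b
  simp [distinguished, ← mul_assoc, h.integral_i, h.lam_i, mul_comm]

/-- The bilinear form of `ε` for `⋆` is that of `λ` for `·`, twisted by `S⁻¹`; this makes `Φ_B`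
Frobenius. -/
lemma IsDualPair.counit_starMul (h : IsDualPair lam i) (hS : ∀ a, S a = antipode k a) (a b : H) :
    counit (R := k) (starMul lam i S a b) = lam (S.symm b * a) := by
  rw [h.starMul_eq_leftHit hS, apply_leftHit, rightHit_counit]
  simp

end DualPair

/-! ### Frobenius homomorphisms whose values are scalar multiples of the unit. -/

section DualBases

variable {k A : Type*} [CommRing k] [AddCommGroup A] [Module k A]
  {m : A →ₗ[k] A →ₗ[k] A} {u : A} {φ : A →ₗ[k] k} {Φ : A →ₗ[k] A}

lemma isDualBasis_iff (hl : ∀ a, m u a = a) (hr : ∀ a, m a u = a) (hΦ : ∀ a, Φ a = φ a • u)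
    {n : ℕ} {x y : Fin n → A} :
    IsDualBasis m Φ x y ↔
      ∀ a, ∑ j, φ (m a (x j)) • y j = a ∧ ∑ j, φ (m (y j) a) • x j = a := by
  simp [IsDualBasis, hΦ, hl, hr]

lemma isFrobeniusHom_of_functional (hl : ∀ a, m u a = a) (hr : ∀ a, m a u = a)
    (hΦ : ∀ a, Φ a = φ a • u) (hrange : LinearMap.range Φ = Submodule.span k {u})
    (hb : ∃ (n : ℕ) (x y : Fin n → A), ∀ a,
      ∑ j, φ (m a (x j)) • y j = a ∧ ∑ j, φ (m (y j) a) • x j = a) :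
    IsFrobeniusHom m u (LinearMap.range Φ) Φ where
  one_mem := by rw [hrange]; exact Submodule.mem_span_singleton_self u
  mul_mem x hx y hy := by
    rw [hrange, Submodule.mem_span_singleton] at *
    obtain ⟨c, rfl⟩ := hx
    obtain ⟨d, rfl⟩ := hy
    exact ⟨c * d, by simp [hl, smul_smul, mul_comm]⟩
  map_mem a := LinearMap.mem_range_self Φ a
  map_left x hx a := by
    rw [hrange, Submodule.mem_span_singleton] at hx
    obtain ⟨c, rfl⟩ := hx
    simp [hl]
  map_right x hx a := by
    rw [hrange, Submodule.mem_span_singleton] at hx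
    obtain ⟨c, rfl⟩ := hx
    simp [hr]
  exists_dualBasis := by
    obtain ⟨n, x, y, hxy⟩ := hb
    exact ⟨n, x, y, (isDualBasis_iff hl hr hΦ).2 hxy⟩

lemma range_eq_span_of_functional (hΦ : ∀ a, Φ a = φ a • u) {a : A} (ha : φ a = 1) :
    LinearMap.range Φ = Submodule.span k {u} := by
  ext b
  rw [Submodule.mem_span_singleton]
  constructor
  · rintro ⟨c, rfl⟩
    exact ⟨φ c, (hΦ c).symm⟩
  · rintro ⟨c, rfl⟩
    exact ⟨c • a, by simp [hΦ, ha]⟩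

/-- The tensor of a dual basis is determined by either of the two halves of its definition. -/
lemma sum_tmul_eq_of_dual {n : ℕ} {x y : Fin n → A}
    (hxy : ∀ a, ∑ j, φ (m a (x j)) • y j = a) {t : A ⊗[k] A}
    (ht : ∀ a, TensorProduct.rid k A ((φ ∘ₗ m.flip a).lTensor A t) = a) :
    ∑ j, x j ⊗ₜ[k] y j = t := by
  -- Expand the second leg of `t` in the `y j`; the coefficients contract the first leg to `x j`.
  have h1 : ∀ t : A ⊗[k] A,
      ∑ j, TensorProduct.rid k A ((φ ∘ₗ m.flip (x j)).lTensor A t) ⊗ₜ[k] y j = t := by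
    intro t
    induction t with
    | zero => simp
    | add a b ha hb =>
      simp only [map_add, TensorProduct.add_tmul, Finset.sum_add_distrib, ha, hb]
    | tmul a b =>
      conv_rhs => rw [← hxy b, TensorProduct.tmul_sum]
      simp [TensorProduct.smul_tmul]
  simpa [ht] using h1 t

lemma exists_dual_of_tensor {t : A ⊗[k] A}
    (h1 : ∀ a, TensorProduct.lid k A ((φ ∘ₗ m a).rTensor A t) = a)
    (h2 : ∀ a, TensorProduct.rid k A ((φ ∘ₗ m.flip a).lTensor A t) = a) :
    ∃ (n : ℕ) (x y : Fin n → A), ∀ a,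
      ∑ j, φ (m a (x j)) • y j = a ∧ ∑ j, φ (m (y j) a) • x j = a := by
  obtain ⟨n, x, y, rfl⟩ := TensorProduct.exists_sum_tmul_eq t
  exact ⟨n, x, y, fun a => ⟨by simpa using h1 a, by simpa using h2 a⟩⟩

end DualBases

/-! ### The Nakayama automorphism and dual bases of `ε` and `σ` for `⋆`. -/

section Nakayama

variable {k : Type*} [CommRing k] {H : Type*} [Ring H] [HopfAlgebra k H]
  {lam : H →ₗ[k] k} {i : H}

/-- The Nakayama automorphism of a Frobenius integral. -/
lemma IsDualPair.exists_nakayama (h : IsDualPair lam i) :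
    ∃ ν : H ≃ₐ[k] H, ∀ a c, lam (a * c) = lam (ν c * a) := by
  let G : H →ₗ[k] (H →ₗ[k] k) := (LinearMap.mul k H).compr₂ lam
  have hG : ∀ a b, G a b = lam (a * b) := fun _ _ => rfl
  have hGb : Function.Bijective G := h.bijective_mulLeft
  -- `λ` identifies `H` with its dual in two ways, `c ↦ λ(· c)` and `c ↦ λ(c ·)`; `ν` is their
  -- comparison.
  let n : H ≃ₗ[k] H :=
    (LinearEquiv.ofBijective _ h.bijective_fourierMap).trans (LinearEquiv.ofBijective G hGb).symm
  have hn : ∀ a c, lam (a * c) = lam (n c * a) := fun a c => by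
    have : G (n c) = fourierMap lam c := (LinearEquiv.ofBijective G hGb).apply_symm_apply _
    rw [← hG (n c), this, fourierMap_apply]
  refine ⟨AlgEquiv.ofLinearEquiv n ?_ ?_, hn⟩
  · apply hGb.1
    ext b
    simp [hG, ← hn]
  · intro c d
    apply hGb.1
    ext a
    rw [hG, hG, ← hn, ← mul_assoc, hn, ← mul_assoc, hn, ← mul_assoc]

variable {ν : H ≃ₐ[k] H}

lemma IsDualPair.nakayama_unique (h : IsDualPair lam i)
    (hν : ∀ a c, lam (a * c) = lam (ν c * a)) {c d : H}
    (hd : ∀ a, lam (a * c) = lam (d * a)) : d = ν c := by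
  apply h.bijective_mulLeft.1
  ext a
  simp [← hd, ← hν]

variable {S : H ≃ₗ[k] H}

lemma fourierMap_eq (hν : ∀ a c, lam (a * c) = lam (ν c * a)) (a : H) :
    fourierMap lam a = lam ∘ₗ LinearMap.mulLeft k (ν a) := by
  ext b
  exact hν b a

/-- The counterpart of `IsDualPair.counit_starMul` for `Φ_T`, with `S ν` in place of `S⁻¹`. -/
lemma IsDualPair.distinguished_starMul (h : IsDualPair lam i) (hS : ∀ a, S a = antipode k a)
    (hν : ∀ a c, lam (a * c) = lam (ν c * a)) (a b : H) :
    distinguished lam i (starMul lam i S a b) = lam (S (ν b) * a) := by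
  change lam (i * starMul lam i S a b) = _
  rw [h.lam_mul_starMul hS, dualMul_apply_leftHit, fourierMap_eq hν b, h.leftHit_mulLeft_i, hS]
  rfl

lemma IsDualPair.lam_symm_i_mul (h : IsDualPair lam i) (hS : ∀ a, S a = antipode k a) (a : H) :
    lam (S.symm i * a) = counit (R := k) a := by
  rw [← h.counit_starMul hS, h.starMul_i hS]

/-- The dual basis tensor of the top base homomorphism. -/
def topTensor (i : H) (S : H ≃ₗ[k] H) (ν : H ≃ₐ[k] H) : H ⊗[k] H :=
  TensorProduct.map ν.symm.toLinearMap ν.symm.toLinearMap (comul (S.symm i))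

lemma topTensor_eq_sum :
    topTensor i S ν = ∑ j ∈ (ℛ k (S.symm i)).index,
      ν.symm ((ℛ k (S.symm i)).left j) ⊗ₜ[k] ν.symm ((ℛ k (S.symm i)).right j) := by
  rw [topTensor, ← (ℛ k (S.symm i)).eq]
  simp

lemma IsDualPair.rightHit_symm_i (h : IsDualPair lam i) (hS : ∀ a, S a = antipode k a)
    (hν : ∀ a c, lam (a * c) = lam (ν c * a)) (a : H) :
    rightHit (fourierMap lam a ∘ₗ S.toLinearMap) (S.symm i) = ν a := by
  apply S.injective
  rw [← h.leftHit_antipode hS, S.apply_symm_apply, fourierMap_eq hν, h.leftHit_mulLeft_i, hS]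

lemma IsDualPair.rTensor_topTensor (h : IsDualPair lam i) (hS : ∀ a, S a = antipode k a)
    (hν : ∀ a c, lam (a * c) = lam (ν c * a)) (a : H) :
    TensorProduct.lid k H ((distinguished lam i ∘ₗ starMul lam i S a).rTensor H
      (topTensor i S ν)) = a := by
  apply ν.injective
  refine Eq.trans ?_ (h.rightHit_symm_i hS hν a)
  rw [topTensor_eq_sum, rightHit_eq_sum _ (ℛ k (S.symm i))]
  simp [h.distinguished_starMul hS hν]

lemma IsDualPair.lTensor_topTensor (h : IsDualPair lam i) (hS : ∀ a, S a = antipode k a)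
    (hν : ∀ a c, lam (a * c) = lam (ν c * a)) (a : H) :
    TensorProduct.rid k H ((distinguished lam i ∘ₗ (starMul lam i S).flip a).lTensor H
      (topTensor i S ν)) = a := by
  apply ν.injective
  apply S.injective
  have h1 := h.leftHit_mulLeft (S (ν a)) (S.symm i)
  have h2 : lam ∘ₗ LinearMap.mulLeft k (S.symm i) = counit (R := k) := by
    ext b; exact h.lam_symm_i_mul hS b
  rw [h2, leftHit_counit, ← hS] at h1
  rw [h1, topTensor_eq_sum, leftHit_eq_sum _ (ℛ k (S.symm i))]
  simp [h.distinguished_starMul hS hν, hν _ (ν.symm _)]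

lemma IsDualPair.rTensor_comul_i (h : IsDualPair lam i) (hS : ∀ a, S a = antipode k a) (a : H) :
    TensorProduct.lid k H ((counit ∘ₗ starMul lam i S a).rTensor H (comul i)) = a := by
  have := h.invFourier_fourierMap hS a
  conv_rhs => rw [← this]
  rw [invFourier_apply, rightHit]
  have h2 : counit ∘ₗ starMul lam i S a = fourierMap lam a ∘ₗ S.symm.toLinearMap := by
    ext b; simp [h.counit_starMul hS]
  rw [h2]; rfl

lemma IsDualPair.lTensor_comul_i (h : IsDualPair lam i) (hS : ∀ a, S a = antipode k a) (a : H) :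
    TensorProduct.rid k H ((counit ∘ₗ (starMul lam i S).flip a).lTensor H (comul i)) = a := by
  have h1 := h.leftHit_mulLeft_i (S.symm a)
  rw [← hS, S.apply_symm_apply] at h1
  conv_rhs => rw [← h1]
  have h2 : counit ∘ₗ (starMul lam i S).flip a = lam ∘ₗ LinearMap.mulLeft k (S.symm a) := by
    ext b; simp [h.counit_starMul hS]
  rw [h2]; rfl

end Nakayama

/-! ### The distributive Frobenius double algebra. -/

section Double

variable {k : Type*} [CommRing k] {H : Type*} [Ring H] [HopfAlgebra k H]
  {lam : H →ₗ[k] k} {i : H} {S : H ≃ₗ[k] H} {ν : H ≃ₐ[k] H}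

@[simp] lemma hopfDouble_vmul (a b : H) : (hopfDouble lam i S).vmul a b = a * b := rfl

@[simp] lemma hopfDouble_e : (hopfDouble lam i S).e = 1 := rfl

@[simp] lemma hopfDouble_hmul : (hopfDouble lam i S).hmul = starMul lam i S := rfl

@[simp] lemma hopfDouble_i : (hopfDouble lam i S).i = i := rfl

lemma IsDualPair.phiL_eq (h : IsDualPair lam i) (hS : ∀ a, S a = antipode k a) (a : H) :
    (hopfDouble lam i S).phiL a = lam a • (1 : H) := h.starMul_one hS a

lemma IsDualPair.phiR_eq (h : IsDualPair lam i) (hS : ∀ a, S a = antipode k a) (a : H) :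
    (hopfDouble lam i S).phiR a = (lam ∘ₗ S.symm.toLinearMap) a • (1 : H) := h.one_starMul hS a

lemma IsDualPair.phiB_eq (h : IsDualPair lam i) (a : H) :
    (hopfDouble lam i S).phiB a = counit (R := k) a • i := h.integral_i a

lemma IsDualPair.phiT_eq (h : IsDualPair lam i) (a : H) :
    (hopfDouble lam i S).phiT a = distinguished lam i a • i := h.i_mul a

lemma IsDualPair.baseL_eq (h : IsDualPair lam i) (hS : ∀ a, S a = antipode k a) :
    (hopfDouble lam i S).baseL = Submodule.span k {1} :=
  range_eq_span_of_functional (h.phiL_eq hS) h.lam_i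

lemma IsDualPair.baseR_eq (h : IsDualPair lam i) (hS : ∀ a, S a = antipode k a) :
    (hopfDouble lam i S).baseR = Submodule.span k {1} :=
  range_eq_span_of_functional (a := S i) (h.phiR_eq hS) (by simp [h.lam_i])

lemma IsDualPair.baseB_eq (h : IsDualPair lam i) :
    (hopfDouble lam i S).baseB = Submodule.span k {i} :=
  range_eq_span_of_functional (a := 1) h.phiB_eq (by simp)

lemma IsDualPair.baseT_eq (h : IsDualPair lam i) :
    (hopfDouble lam i S).baseT = Submodule.span k {i} :=
  range_eq_span_of_functional (a := 1) h.phiT_eq (by simp [distinguished, h.lam_i])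

lemma IsDualPair.lam_symm_i (h : IsDualPair lam i) (hS : ∀ a, S a = antipode k a) :
    lam (S.symm i) = 1 := by
  have := h.counit_starMul hS 1 i
  rw [h.starMul_i hS] at this
  simpa using this.symm

lemma IsDualPair.isDoubleAlgebra (h : IsDualPair lam i) (hS : ∀ a, S a = antipode k a) :
    (hopfDouble lam i S).IsDoubleAlgebra where
  vmul_assoc := mul_assoc
  e_vmul := one_mul
  vmul_e := mul_one
  hmul_assoc := h.starMul_assoc hS
  i_hmul := h.i_starMul hS
  hmul_i := h.starMul_i hS
  ax1 a b := by simp [h.starMul_one hS, h.i_starMul hS]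
  ax2 a b := by simp [h.starMul_one hS, h.i_starMul hS]
  ax3 a b := by simp [h.starMul_one hS, h.i_starMul hS, h.integral_i, h.lam_i]
  ax4 a b := by simp [h.integral_i, h.starMul_i hS, h.one_starMul hS, h.lam_symm_i hS]
  ax5 a b := by simp [h.one_starMul hS, h.starMul_i hS]
  ax6 a b := by simp [h.one_starMul hS, h.starMul_i hS]
  ax7 a b := by simp [h.i_mul, h.starMul_i hS, h.one_starMul hS, h.lam_symm_i hS]
  ax8 a b := by simp [h.starMul_one hS, h.i_starMul hS, h.i_mul, h.lam_i]

lemma IsDualPair.isFrobenius (h : IsDualPair lam i) (hS : ∀ a, S a = antipode k a)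
    (hν : ∀ a c, lam (a * c) = lam (ν c * a)) : (hopfDouble lam i S).IsFrobenius where
  toIsDoubleAlgebra := h.isDoubleAlgebra hS
  frobL := isFrobeniusHom_of_functional one_mul mul_one (h.phiL_eq hS) (h.baseL_eq hS)
    h.frobenius_lam
  frobR := by
    refine isFrobeniusHom_of_functional one_mul mul_one (h.phiR_eq hS) (h.baseR_eq hS) ?_
    obtain ⟨n, x, y, hxy⟩ := h.frobenius_lam
    -- `S` reverses products, so the two dual bases of `λ` trade places for `λ S⁻¹`.
    refine ⟨n, fun j => S (y j), fun j => S (x j), fun a => ⟨?_, ?_⟩⟩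
    · apply S.symm.injective
      simpa [symm_mul hS] using (hxy (S.symm a)).2
    · apply S.symm.injective
      simpa [symm_mul hS] using (hxy (S.symm a)).1
  frobB := isFrobeniusHom_of_functional (h.i_starMul hS) (h.starMul_i hS) h.phiB_eq h.baseB_eq
    (exists_dual_of_tensor (h.rTensor_comul_i hS) (h.lTensor_comul_i hS))
  frobT := isFrobeniusHom_of_functional (h.i_starMul hS) (h.starMul_i hS) h.phiT_eq h.baseT_eq
    (exists_dual_of_tensor (h.rTensor_topTensor hS hν) (h.lTensor_topTensor hS hν))

/-- The comultiplication of the bottom base homomorphism is that of the Hopf algebra. -/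
lemma IsDualPair.sum_starMul_tmul (h : IsDualPair lam i) (hS : ∀ a, S a = antipode k a)
    {n : ℕ} {u v : Fin n → H}
    (huv : IsDualBasis (hopfDouble lam i S).hmul (hopfDouble lam i S).phiB u v) (a : H) :
    ∑ j, starMul lam i S a (u j) ⊗ₜ[k] v j = comul (R := k) a := by
  have h1 := (isDualBasis_iff (h.i_starMul hS) (h.starMul_i hS) h.phiB_eq).1 huv
  have h2 := sum_tmul_eq_of_dual (fun a => (h1 a).1) (h.lTensor_comul_i hS)
  have h3 := congrArg (TensorProduct.map (starMul lam i S a) LinearMap.id) h2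
  simp only [map_sum, TensorProduct.map_tmul, LinearMap.id_apply] at h3
  -- The dual basis tensor is now `Δ(i)`; `a ⋆ i₍₁₎ ⊗ i₍₂₎ = a₍₁₎ ⊗ λ(S⁻¹(i₍₁₎) a₍₂₎) i₍₂₎`, and
  -- Fourier inversion turns the second leg into `a₍₂₎`.
  rw [h3, ← (ℛ k i).eq]
  simp only [map_sum, TensorProduct.map_tmul, LinearMap.id_apply, h.starMul_eq_leftHit hS a,
    leftHit_eq_sum _ (ℛ k a), TensorProduct.sum_tmul, TensorProduct.smul_tmul]
  rw [Finset.sum_comm]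
  conv_rhs => rw [← (ℛ k a).eq]
  refine Finset.sum_congr rfl fun l _ => ?_
  rw [← TensorProduct.tmul_sum]
  congr 1
  have := h.invFourier_fourierMap hS ((ℛ k a).right l)
  rw [invFourier_apply, rightHit_eq_sum _ (ℛ k i)] at this
  simpa using this

lemma IsDualPair.distribB (h : IsDualPair lam i) (hS : ∀ a, S a = antipode k a)
    {n : ℕ} {u v : Fin n → H}
    (huv : IsDualBasis (hopfDouble lam i S).hmul (hopfDouble lam i S).phiB u v) (a b c : H) :
    a * starMul lam i S b c =
      ∑ j, starMul lam i S (starMul lam i S a (u j) * b) (v j * c) := by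
  let M : H ⊗[k] H →ₗ[k] H := TensorProduct.lift
    ((starMul lam i S).compl₁₂ (LinearMap.mulRight k b) (LinearMap.mulRight k c))
  have h1 := congrArg M (h.sum_starMul_tmul hS huv a)
  rw [← (ℛ k a).eq] at h1
  simp only [M, map_sum, TensorProduct.lift.tmul, LinearMap.compl₁₂_apply,
    LinearMap.mulRight_apply] at h1
  rw [h1]
  apply h.bijective_fourierMap.1
  ext x
  simp only [map_sum, LinearMap.sum_apply, h.fourierMap_starMul hS, dualMul_eq_sum _ _ (ℛ k x)]
  rw [fourierMap_apply, ← mul_assoc, h.lam_mul_starMul hS,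
    dualMul_eq_sum _ _ ((ℛ k x).mul (ℛ k a))]
  simp only [Coalgebra.Repr.mul_index, Coalgebra.Repr.mul_left, Coalgebra.Repr.mul_right]
  rw [Finset.sum_product_right]
  simp [mul_assoc]

lemma sum_mul_eq_of_dual {φ : H →ₗ[k] k} {n : ℕ} {x y : Fin n → H}
    (hxy : ∀ a, ∑ j, φ (a * x j) • y j = a) (p q : H) :
    ∑ j, φ (p * x j) * φ (q * y j) = φ (q * p) := by
  conv_rhs => rw [← hxy p]
  simp [Finset.mul_sum]

/-- With `a ⋆ b = λ(S⁻¹(b₍₁₎) a) b₍₂₎`, the dual bases split the scalar `λ(S⁻¹(c₍₁₎) S⁻¹(b₍₁₎) a)`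
into two factors. -/
lemma IsDualPair.distribL (h : IsDualPair lam i) (hS : ∀ a, S a = antipode k a)
    {n : ℕ} {x y : Fin n → H} (hxy : ∀ a, ∑ j, lam (a * x j) • y j = a) (a b c : H) :
    starMul lam i S a (b * c) =
      ∑ j, starMul lam i S (a * x j) b * starMul lam i S (y j) c := by
  simp only [h.starMul_eq_rightHit hS, rightHit_eq_sum _ (ℛ k b), rightHit_eq_sum _ (ℛ k c),
    rightHit_eq_sum _ ((ℛ k b).mul (ℛ k c)), Finset.sum_mul_sum]
  rw [Finset.sum_comm, Coalgebra.Repr.mul_index, Finset.sum_product]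
  refine Finset.sum_congr rfl fun l _ => ?_
  rw [Finset.sum_comm]
  refine Finset.sum_congr rfl fun r _ => ?_
  have h1 := sum_mul_eq_of_dual hxy (S.symm ((ℛ k b).left l) * a) (S.symm ((ℛ k c).left r))
  rw [← mul_assoc, ← symm_mul hS] at h1
  simp only [smul_mul_smul_comm, ← Finset.sum_smul, Coalgebra.Repr.mul_left,
    Coalgebra.Repr.mul_right, LinearMap.comp_apply, LinearEquiv.coe_coe, fourierMap_apply]
  rw [← h1]
  simp only [mul_assoc]

lemma IsDualPair.distribR (h : IsDualPair lam i) (hS : ∀ a, S a = antipode k a)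
    {n : ℕ} {x y : Fin n → H}
    (hxy : ∀ a, ∑ j, (lam ∘ₗ S.symm.toLinearMap) (a * x j) • y j = a) (a b c : H) :
    starMul lam i S (b * c) a =
      ∑ j, starMul lam i S b (a * x j) * starMul lam i S c (y j) := by
  simp only [h.starMul_eq_leftHit hS, leftHit_eq_sum _ (ℛ k b), leftHit_eq_sum _ (ℛ k c),
    leftHit_eq_sum _ ((ℛ k b).mul (ℛ k c)), Finset.sum_mul_sum]
  rw [Finset.sum_comm, Coalgebra.Repr.mul_index, Finset.sum_product]
  refine Finset.sum_congr rfl fun l _ => ?_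
  rw [Finset.sum_comm]
  refine Finset.sum_congr rfl fun r _ => ?_
  have h1 := sum_mul_eq_of_dual hxy (S ((ℛ k b).right l) * a) (S ((ℛ k c).right r))
  simp only [LinearMap.comp_apply, LinearEquiv.coe_coe, symm_mul hS, S.symm_apply_apply] at h1
  simp only [smul_mul_smul_comm, ← Finset.sum_smul, Coalgebra.Repr.mul_left,
    Coalgebra.Repr.mul_right, LinearMap.comp_apply, LinearMap.mulLeft_apply, symm_mul hS]
  rw [← mul_assoc, ← h1]
  simp only [mul_assoc]

/-- With `t = S⁻¹ i`, the left side is the triple convolution of `F(a) S`, `F(y)`, `F(z)` at `t`;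
absorbing the first factor into `t` leaves `ν(a)`. -/
lemma IsDualPair.sum_lam_starMul_mul_lam (h : IsDualPair lam i)
    (hS : ∀ a, S a = antipode k a) (hν : ∀ a c, lam (a * c) = lam (ν c * a))
    {n : ℕ} {u v : Fin n → H}
    (huv : IsDualBasis (hopfDouble lam i S).hmul (hopfDouble lam i S).phiT u v) (a y z : H) :
    ∑ j, lam (y * starMul lam i S a (u j)) * lam (z * v j) =
      dualMul (fourierMap lam y) (fourierMap lam z) (ν a) := by
  have h1 := (isDualBasis_iff (h.i_starMul hS) (h.starMul_i hS) h.phiT_eq).1 huv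
  have h2 := sum_tmul_eq_of_dual (fun a => (h1 a).1) (h.lTensor_topTensor hS hν)
  let M : H ⊗[k] H →ₗ[k] k := TensorProduct.lift ((LinearMap.mul k k).compl₁₂
    (lam ∘ₗ LinearMap.mulLeft k y ∘ₗ starMul lam i S a) (lam ∘ₗ LinearMap.mulLeft k z))
  have h3 := congrArg M h2
  rw [topTensor_eq_sum] at h3
  simp only [M, map_sum, TensorProduct.lift.tmul, LinearMap.compl₁₂_apply, LinearMap.comp_apply,
    LinearMap.mulLeft_apply, LinearMap.mul_apply'] at h3
  rw [h3, ← h.rightHit_symm_i hS hν a, ← dualMul_apply_rightHit, ← dualMul_assoc,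
    dualMul_eq_sum _ _ (ℛ k (S.symm i))]
  refine Finset.sum_congr rfl fun l _ => ?_
  rw [hν z, ν.apply_symm_apply, h.lam_mul_starMul hS, dualMul_apply_leftHit,
    fourierMap_eq hν (ν.symm _), ν.apply_symm_apply, h.leftHit_mulLeft, ← hS,
    dualMul_apply_leftHit]
  rfl

lemma IsDualPair.distribT (h : IsDualPair lam i) (hS : ∀ a, S a = antipode k a)
    (hν : ∀ a c, lam (a * c) = lam (ν c * a)) {n : ℕ} {u v : Fin n → H}
    (huv : IsDualBasis (hopfDouble lam i S).hmul (hopfDouble lam i S).phiT u v) (a b c : H) :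
    starMul lam i S b c * a = ∑ j, starMul lam i S (b * starMul lam i S a (u j)) (c * v j) := by
  apply h.bijective_fourierMap.1
  ext x
  simp only [map_sum, LinearMap.sum_apply, h.fourierMap_starMul hS, dualMul_eq_sum _ _ (ℛ k x)]
  -- `ν` carries the right factor `a` to the left under `λ`, where `Δ(ν(a) x)` can be expanded.
  rw [Finset.sum_comm, fourierMap_apply, ← mul_assoc, hν, ← mul_assoc, h.lam_mul_starMul hS,
    dualMul_eq_sum _ _ ((ℛ k (ν a)).mul (ℛ k x)), Coalgebra.Repr.mul_index,
    Finset.sum_product_right]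
  refine Finset.sum_congr rfl fun l _ => ?_
  simp only [fourierMap_apply, ← mul_assoc, h.sum_lam_starMul_mul_lam hS hν huv,
    dualMul_eq_sum _ _ (ℛ k (ν a)), Coalgebra.Repr.mul_left, Coalgebra.Repr.mul_right]

lemma IsDualPair.isDistributive (h : IsDualPair lam i) (hS : ∀ a, S a = antipode k a)
    (hν : ∀ a c, lam (a * c) = lam (ν c * a)) : (hopfDouble lam i S).IsDistributive where
  toIsFrobenius := h.isFrobenius hS hν
  distribB _ _ _ huv := h.distribB hS huv
  distribL _ _ _ hxy := h.distribL hS fun a =>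
    ((isDualBasis_iff one_mul mul_one (h.phiL_eq hS)).1 hxy a).1
  distribT _ _ _ huv := h.distribT hS hν huv
  distribR _ _ _ hxy := h.distribR hS fun a =>
    ((isDualBasis_iff one_mul mul_one (h.phiR_eq hS)).1 hxy a).1

end Double

/-! ### Existence, uniqueness and the deformed form of the double algebraic antipode. -/

section Antipode

variable {k : Type*} [CommRing k] {H : Type*} [Ring H] [HopfAlgebra k H]
  {lam : H →ₗ[k] k} {i : H} {S : H ≃ₗ[k] H} {ν : H ≃ₐ[k] H}

open WithConv in
/-- `i₍₁₎ a ⊗ i₍₂₎ = i₍₁₎ ⊗ i₍₂₎ s(a)` for the deformed antipode `s`. -/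
lemma IsDualPair.comul_i_mul_tmul_one (h : IsDualPair lam i) (a : H) :
    comul (R := k) i * (a ⊗ₜ[k] 1) =
      comul i * (1 ⊗ₜ[k] deformedAntipode (distinguished lam i) a) := by
  let ι₁ : H →ₗ[k] H ⊗[k] H := (TensorProduct.mk k H H).flip 1
  let ι₂ : H →ₗ[k] H ⊗[k] H := TensorProduct.mk k H H 1
  have hinv : toConv ι₂ * toConv (ι₂ ∘ₗ antipode k) = 1 := by
    ext b
    have h1 := congrArg ι₂ (sum_mul_antipode_eq_smul (R := k) (ℛ k b))
    refine (convMul_eq_sum _ _ (ℛ k b)).trans ?_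
    simpa [ι₂, Algebra.algebraMap_eq_smul_one, Algebra.TensorProduct.one_def,
      TensorProduct.tmul_sum] using h1
  -- Both sides compute `Δ(i b)`, once by multiplicativity and once from `i b = σ(b) i`.
  have hmul : toConv (LinearMap.mulLeft k (comul i) ∘ₗ ι₁) * toConv ι₂ =
      toConv ((distinguished lam i).smulRight (comul (R := k) i)) := by
    ext b
    have h1 := congrArg (comul (R := k)) (h.i_mul b)
    rw [Bialgebra.comul_mul, map_smul] at h1
    conv_lhs at h1 => rw [← (ℛ k b).eq, Finset.mul_sum]
    refine (convMul_eq_sum _ _ (ℛ k b)).trans ?_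
    simpa [ι₁, ι₂, mul_assoc] using h1
  have h2 := congrArg (fun f => f.ofConv a) (eq_conv_of_conv_mul hinv hmul)
  replace h2 := h2.trans (convMul_eq_sum _ _ (ℛ k a))
  refine h2.trans ?_
  rw [deformedAntipode, LinearMap.comp_apply, rightHit_eq_sum _ (ℛ k a)]
  simp [ι₂, Finset.mul_sum, TensorProduct.tmul_sum]

lemma IsDualPair.deformedAntipode_eq (h : IsDualPair lam i) (hS : ∀ a, S a = antipode k a)
    (hν : ∀ a c, lam (a * c) = lam (ν c * a)) (a : H) :
    deformedAntipode (distinguished lam i) a = ν.symm (S.symm a) := by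
  have h1 := h.comul_i_mul_tmul_one a
  rw [← (ℛ k i).eq, Finset.sum_mul, Finset.sum_mul] at h1
  simp only [Algebra.TensorProduct.tmul_mul_tmul, mul_one] at h1
  -- Contracting the first leg with `λ S⁻¹` makes Fourier inversion applicable to each side of the
  -- exchange rule.
  have h2 := congrArg (TensorProduct.lid k H ∘ (lam ∘ₗ S.symm.toLinearMap).rTensor H) h1
  simp only [Function.comp_apply, map_sum, LinearMap.rTensor_tmul, TensorProduct.lid_tmul,
    LinearMap.comp_apply, LinearEquiv.coe_coe, symm_mul hS] at h2
  have h3 : ∀ c, ∑ l ∈ (ℛ k i).index, lam (S.symm ((ℛ k i).left l) * c) • (ℛ k i).right l = c :=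
    fun c => by
      have := h.invFourier_fourierMap hS c
      rw [invFourier_apply, rightHit_eq_sum _ (ℛ k i)] at this
      simpa using this
  have h4 := h3 (ν.symm (S.symm a))
  simp only [hν _ (ν.symm _), ν.apply_symm_apply] at h4
  rw [← h4, h2]
  have h5 := h3 1
  simp only [mul_one] at h5
  conv_lhs => rw [← one_mul (deformedAntipode _ a), ← h5, Finset.sum_mul]
  simp

lemma IsDualPair.isAntipode (h : IsDualPair lam i) (hS : ∀ a, S a = antipode k a)
    (hν : ∀ a c, lam (a * c) = lam (ν c * a)) {s : H →ₗ[k] H}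
    (hs : ∀ a, s a = ν.symm (S.symm a)) : (hopfDouble lam i S).IsAntipode s := by
  have hlam : ∀ b a, lam (b * s a) = lam (S.symm a * b) := fun b a => by
    rw [hν, hs, ν.apply_symm_apply]
  have hF : ∀ a, fourierMap lam (s a) = lam ∘ₗ LinearMap.mulLeft k (S.symm a) := fun a => by
    ext b; exact hlam b a
  refine ⟨fun a b c => ?_, fun a b c => ?_, fun a b c => ?_, fun a b c => ?_⟩
  · rw [h.phiB_eq, h.phiB_eq]
    simp only [hopfDouble_vmul, hopfDouble_hmul, h.counit_starMul hS, symm_mul hS]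
    rw [← mul_assoc (S.symm c), hlam, mul_assoc]
  · rw [h.phiR_eq hS, h.phiR_eq hS]
    simp only [hopfDouble_vmul, hopfDouble_hmul, LinearMap.comp_apply, LinearEquiv.coe_coe]
    congr 1
    have h1 := h.rightHit_antipode hS (fourierMap lam (s a) ∘ₗ S.symm.toLinearMap) (S.symm b)
    have h2 := h.leftHit_antipode hS (lam ∘ₗ LinearMap.mulLeft k (S.symm c)) (S.symm a)
    have h3 : (fourierMap lam (s a) ∘ₗ S.symm.toLinearMap) ∘ₗ S.toLinearMap =
        lam ∘ₗ LinearMap.mulLeft k (S.symm a) := by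
      rw [← hF]; ext; simp
    rw [S.apply_symm_apply] at h1 h2
    rw [symm_mul hS, symm_mul hS, h.starMul_eq_leftHit hS a, h.starMul_eq_rightHit hS _ b, h1, h2,
      h3, S.symm_apply_apply, S.symm_apply_apply, ← fourierMap_apply, ← apply_leftHit,
      h.leftHit_mulLeft (S.symm b), ← hS]
    rfl
  · rw [h.phiL_eq hS, h.phiL_eq hS]
    simp only [hopfDouble_vmul, hopfDouble_hmul]
    rw [h.lam_mul_starMul hS, h.starMul_eq_leftHit hS, dualMul_apply_leftHit, hF,
      fourierMap_apply]
  · rw [h.phiT_eq, h.phiT_eq]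
    simp only [hopfDouble_vmul, hopfDouble_hmul]
    congr 1
    change lam (i * starMul lam i S (a * b) c) = lam (i * starMul lam i S b (s a * c))
    rw [h.lam_mul_starMul hS, h.lam_mul_starMul hS, dualMul_eq_sum _ _ (ℛ k i),
      dualMul_eq_sum _ _ (ℛ k i)]
    have h1 := h.comul_i_mul_tmul_one a
    rw [h.deformedAntipode_eq hS hν, ← hs, ← (ℛ k i).eq, Finset.sum_mul, Finset.sum_mul] at h1
    let M : H ⊗[k] H →ₗ[k] k := TensorProduct.lift ((LinearMap.mul k k).compl₁₂
      (fourierMap lam b) (fourierMap lam c))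
    have h2 := congrArg M h1
    simpa [M, mul_assoc] using h2

lemma IsDualPair.eq_of_isAntipode (h : IsDualPair lam i) (hS : ∀ a, S a = antipode k a)
    (hν : ∀ a c, lam (a * c) = lam (ν c * a)) {s : H →ₗ[k] H}
    (hs : (hopfDouble lam i S).IsAntipode s) (a : H) : s a = ν.symm (S.symm a) := by
  apply h.bijective_fourierMap.1
  ext c
  -- The bottom axiom alone suffices: this instance reads `λ(S⁻¹(a) c) = λ(c s(a))`, which
  -- determines `s(a)`.
  have h1 := hs.antiB a 1 (S c)
  rw [h.phiB_eq, h.phiB_eq] at h1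
  simp only [hopfDouble_vmul, hopfDouble_hmul, h.counit_starMul hS, symm_mul hS, one_mul,
    mul_one, S.symm_apply_apply] at h1
  have h2 := congrArg lam h1
  simp only [map_smul, h.lam_i, smul_eq_mul, mul_one] at h2
  rw [fourierMap_apply, fourierMap_apply, ← h2, hν c (ν.symm _), ν.apply_symm_apply]

end Antipode

/-! ### Recovering the Hopf algebra from the double algebra. -/

section Reconstruction

variable {k : Type*} [CommRing k] {H : Type*} [Ring H] [HopfAlgebra k H]
  {lam : H →ₗ[k] k} {i : H} {S : H ≃ₗ[k] H} {ν : H ≃ₐ[k] H}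

/-- Balancing over multiples of the unit imposes nothing beyond `k`-bilinearity. -/
lemma bijective_toTensorOver {A : Type*} [AddCommGroup A] [Module k A]
    {m : A →ₗ[k] A →ₗ[k] A} {u : A} {X : Submodule k A} (hl : ∀ a, m u a = a)
    (hr : ∀ a, m a u = a) (hX : X = Submodule.span k {u}) :
    Function.Bijective (toTensorOver m X) := by
  have h1 : balancingRelations m X = ⊥ := by
    rw [balancingRelations, Submodule.span_eq_bot]
    rintro _ ⟨a, b, x, hx, rfl⟩
    rw [hX, Submodule.mem_span_singleton] at hx
    obtain ⟨c, rfl⟩ := hx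
    simp [hl, hr, TensorProduct.smul_tmul]
  refine ⟨?_, Submodule.mkQ_surjective _⟩
  rw [← LinearMap.ker_eq_bot, toTensorOver, Submodule.ker_mkQ, h1]

lemma IsDualPair.isFrobeniusComul (h : IsDualPair lam i) (hS : ∀ a, S a = antipode k a) :
    IsFrobeniusComul (hopfDouble lam i S).hmul (hopfDouble lam i S).baseB
      (hopfDouble lam i S).phiB
      (toTensorOver (hopfDouble lam i S).hmul (hopfDouble lam i S).baseB ∘ₗ
        Coalgebra.comul) := by
  intro n x y hxy a
  rw [LinearMap.comp_apply, ← h.sum_starMul_tmul hS hxy]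
  rfl

lemma IsDualPair.centralizerOf_baseL (h : IsDualPair lam i) (hS : ∀ a, S a = antipode k a) :
    centralizerOf (hopfDouble lam i S).vmul (hopfDouble lam i S).baseL = ⊤ := by
  rw [eq_top_iff]
  rintro c - x hx
  rw [h.baseL_eq hS, Submodule.mem_span_singleton] at hx
  obtain ⟨r, rfl⟩ := hx
  simp

/-- The Nakayama automorphism of `Φ_L`, on the centralizer of the left base algebra. -/
lemma IsDualPair.exists_nakayamaL (h : IsDualPair lam i) (hS : ∀ a, S a = antipode k a)
    (hν : ∀ a c, lam (a * c) = lam (ν c * a)) :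
    ∃ νL : centralizerOf (hopfDouble lam i S).vmul (hopfDouble lam i S).baseL ≃ₗ[k]
        centralizerOf (hopfDouble lam i S).vmul (hopfDouble lam i S).baseL,
      (∀ ν', IsNakayama (hopfDouble lam i S).vmul (hopfDouble lam i S).baseL
        (hopfDouble lam i S).phiL ν' ↔ ν' = νL) ∧ ∀ c, (νL c : H) = ν c := by
  have htop := h.centralizerOf_baseL hS
  let e := LinearEquiv.ofTop _ htop
  let νL := (e.trans ν.toLinearEquiv).trans e.symm
  have hνL : ∀ c, (νL c : H) = ν c := fun c => by simp [νL, e]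
  refine ⟨νL, fun ν' => ⟨fun hν' => ?_, ?_⟩, hνL⟩
  · ext c
    rw [hνL]
    refine h.nakayama_unique hν fun a => ?_
    have h1 := hν'.twist a c
    rw [h.phiL_eq hS, h.phiL_eq hS] at h1
    simpa using congrArg (counit (R := k)) h1
  · rintro rfl
    refine ⟨fun c d e he => ?_, fun a c => ?_⟩
    · rw [hνL, hνL, hνL, he]
      simp
    · rw [h.phiL_eq hS, h.phiL_eq hS, hνL]
      simp [hν a]

end Reconstruction

theorem mainTheorem10 {k : Type*} [CommRing k] {H : Type*} [Ring H] [HopfAlgebra k H]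
    (lam : H →ₗ[k] k) (i : H) (hpair : IsDualPair lam i) :
    -- the antipode `S` is invertible and the two Fourier transforms are mutually inverse
    ∃ S : H ≃ₗ[k] H, (∀ a, S a = HopfAlgebra.antipode k a) ∧
      (∀ a, invFourier i S (fourierMap lam a) = a) ∧
      (∀ ψ, fourierMap lam (invFourier i S ψ) = ψ) ∧
    -- `⟨H, ·, 1, ⋆, i⟩` is a distributive Frobenius double algebra
    (hopfDouble lam i S).IsDistributive ∧
    -- the base algebras
    (hopfDouble lam i S).baseL = Submodule.span k {1} ∧
    (hopfDouble lam i S).baseR = Submodule.span k {1} ∧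
    (hopfDouble lam i S).baseB = Submodule.span k {i} ∧
    (hopfDouble lam i S).baseT = Submodule.span k {i} ∧
    -- the Nakayama automorphism `ν` of `lam`
    ∃ ν : H ≃ₐ[k] H,
      (∀ ν' : H ≃ₐ[k] H, (∀ a c, lam (a * c) = lam (ν' c * a)) ↔ ν' = ν) ∧
    -- the unique double algebraic antipode `St` is the deformed antipode `ν⁻¹ S⁻¹`
    ∃ St : H ≃ₗ[k] H,
      (∀ s : H →ₗ[k] H, (hopfDouble lam i S).IsAntipode s ↔ s = St.toLinearMap) ∧
      (∀ a, St a = ν.symm (S.symm a)) ∧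
      (∀ a, St a = deformedAntipode (distinguished lam i) a) ∧
    -- reconstruction of the comultiplication: `A ⊗_B A = A ⊗_k A` and `Δ = Δ_B`
      Function.Bijective
        (toTensorOver (hopfDouble lam i S).hmul (hopfDouble lam i S).baseB) ∧
      IsFrobeniusComul (hopfDouble lam i S).hmul (hopfDouble lam i S).baseB
        (hopfDouble lam i S).phiB
        (toTensorOver (hopfDouble lam i S).hmul (hopfDouble lam i S).baseB ∘ₗ
          Coalgebra.comul) ∧
    -- reconstruction of the counit: `k ≅ B` via `c ↦ c i`, and `Φ_B` is the counit
      Function.Injective (fun c : k => c • i) ∧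
      (∀ a, (hopfDouble lam i S).phiB a = Coalgebra.counit (R := k) a • i) ∧
    -- reconstruction of the antipode: `S = St⁻¹ ν_L⁻¹` with the Nakayama automorphism of `Φ_L`
      centralizerOf (hopfDouble lam i S).vmul (hopfDouble lam i S).baseL = ⊤ ∧
      ∃ νL : centralizerOf (hopfDouble lam i S).vmul (hopfDouble lam i S).baseL ≃ₗ[k]
          centralizerOf (hopfDouble lam i S).vmul (hopfDouble lam i S).baseL,
        (∀ ν', IsNakayama (hopfDouble lam i S).vmul (hopfDouble lam i S).baseL
          (hopfDouble lam i S).phiL ν' ↔ ν' = νL) ∧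
        ∀ c : centralizerOf (hopfDouble lam i S).vmul (hopfDouble lam i S).baseL,
          HopfAlgebra.antipode k (c : H) = St.symm (νL.symm c : H) := by
  let S := LinearEquiv.ofBijective (HopfAlgebra.antipode k : H →ₗ[k] H) hpair.bijective_antipode
  have hS : ∀ a, S a = HopfAlgebra.antipode k a := fun _ => rfl
  obtain ⟨ν, hν⟩ := hpair.exists_nakayama
  obtain ⟨νL, hνL, hνL'⟩ := hpair.exists_nakayamaL hS hν
  have hSt : ∀ a, (S.symm.trans ν.symm.toLinearEquiv) a = ν.symm (S.symm a) := fun _ => rfl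
  refine ⟨S, hS, hpair.invFourier_fourierMap hS, hpair.fourierMap_invFourier hS,
    hpair.isDistributive hS hν, hpair.baseL_eq hS, hpair.baseR_eq hS, hpair.baseB_eq,
    hpair.baseT_eq, ν, fun ν' => ⟨fun h => ?_, ?_⟩, S.symm.trans ν.symm.toLinearEquiv,
    fun s => ⟨fun hs => LinearMap.ext (hpair.eq_of_isAntipode hS hν hs), ?_⟩, hSt,
    fun a => (hpair.deformedAntipode_eq hS hν a).symm,
    bijective_toTensorOver (hpair.i_starMul hS) (hpair.starMul_i hS) hpair.baseB_eq,
    hpair.isFrobeniusComul hS, fun c d hcd => ?_, hpair.phiB_eq,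
    hpair.centralizerOf_baseL hS, νL, hνL, fun c => ?_⟩
  · ext c
    exact hpair.nakayama_unique hν fun a => h a c
  · rintro rfl
    exact hν
  · rintro rfl
    exact hpair.isAntipode hS hν hSt
  · simpa [hpair.lam_i] using congrArg lam hcd
  · rw [← hS, LinearEquiv.eq_symm_apply, hSt, S.symm_apply_apply, AlgEquiv.symm_apply_eq, ← hνL',
      LinearEquiv.apply_symm_apply]
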